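/- Let $G$ be a compact Hausdorff topological group (in particular, a finite group or a compact Lie group) with normalized Haar measure $dg$, and let $U$ be a continuous unitary representation of $G$ on a finite-dimensional complex Hilbert space $\mathcal H$. The representation can be decomposed into irreps: up to unitary equivalence $$\mathcal H=\bigoplus_\mu \mathcal M_\mu\otimes\mathcal N_\mu,\qquad U(g)=\bigoplus_\mu U^{(\mu)}(g)\otimes I_{\mathcal N_\mu},$$ where the $\mu$ label finitely many pairwise inequivalent irreducible unitary representations $U^{(\mu)}$ of $G$ on the spaces $\mathcal M_\mu$ of dimension $d_\mu$, and the multiplicity spaces $\mathcal N_\mu$ are nonzero. Fix any such decomposition and let $\Pi_\mu$ be the projection of $\mathcal H$ onto $\mathcal M_\mu\otimes\mathcal N_\mu$. For a unit vector $\psi\in\mathcal H$ let $$\chi_\psi(g)=\langle\psi|U(g)|\psi\rangle,\qquad F_\psi^{(\mu)}=\mathrm{tr}_{\mathcal N_\mu}\big(\Pi_\mu|\psi\rangle\langle\psi|\Pi_\mu\big),\qquad \chi^{(\mu)}_\psi(g)=\mathrm{tr}\big(U^{(\mu)}(g)F_\psi^{(\mu)}\big)$$ be its characteristic function, its reduction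 onto the irrep $\mu$, and the $\mu$ component of its characteristic function. Then for all unit vectors $\psi_1,\psi_2\in\mathcal H$ there exists a unitary $V$ on $\mathcal H$ that is $G$-invariant, i.e. $VU(g)=U(g)V$ for all $g\in G$, such that both $$|\langle\psi_2|V|\psi_1\rangle|\ \ge\ 1-\frac12\Big(\sum_\mu d_\mu^2\Big)\int dg\,\big|\chi_{\psi_1}(g)-\chi_{\psi_2}(g)\big|$$ and $$|\langle\psi_2|V|\psi_1\rangle|\ \ge\ 1-\frac12\sum_\mu d_\mu^2\int dg\,\big|\chi^{(\mu)}_{\psi_1}(g)-\chi^{(\mu)}_{\psi_2}(g)\big|,$$ where both sums run over the irreps $\mu$ in which $\psi_1$ or $\psi_2$ has a nonzero component, i.e. $\Pi_\mu\psi_1\ne0$ or $\Pi_\mu\psi_2\ne0$. -/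

import Mathlib

noncomputable section

/-- The matrix representation `π` of `G` on `ℂ^d`, as a `Representation`. -/
def matrixRep {G : Type*} [Group G] {d : ℕ} (π : G →* Matrix.unitaryGroup (Fin d) ℂ) :
    Representation ℂ G (Fin d → ℂ) where
  toFun g := Matrix.toLin' (π g : Matrix (Fin d) (Fin d) ℂ)
  map_one' := by simp [Module.End.one_eq_id]
  map_mul' g h := by simp [Matrix.toLin'_mul, Module.End.mul_eq_comp]

/-- The partial trace over the second tensor factor of an operator on `ℂ^m ⊗ ℂ^n`. -/
def partialTraceRight {m n : Type*} [Fintype n] (A : Matrix (m × n) (m × n) ℂ) :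
    Matrix m m ℂ :=
  Matrix.of fun i j => ∑ a, A (i, a) (j, a)

variable {G : Type*} [Group G] {H : Type*} [NormedAddCommGroup H] [InnerProductSpace ℂ H]

/-- A decomposition `H = ⨁_μ M_μ ⊗ N_μ`, `U(g) = ⨁_μ U_μ(g) ⊗ 1` of a unitary representation into
pairwise inequivalent irreps `U_μ`, where `M_μ = ℂ^(d_μ)` and `N_μ = ℂ^(n_μ)` are nonzero.
The identification of `H` with the direct sum is given by the orthonormal basis of `H` that
corresponds to the product bases `e_i ⊗ f_a` of the summands `M_μ ⊗ N_μ`. -/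
structure IrrepDecomposition (U : G →* (H ≃ₗᵢ[ℂ] H)) where
  /-- the number of inequivalent irreps that occur -/
  numIrreps : ℕ
  /-- the dimension `d_μ` of the irrep `μ` -/
  dim : Fin numIrreps → ℕ
  /-- the multiplicity `n_μ` of the irrep `μ` -/
  mult : Fin numIrreps → ℕ
  mult_pos : ∀ μ, 0 < mult μ
  /-- the unitary irrep `U_μ` -/
  irrep : ∀ μ, G →* Matrix.unitaryGroup (Fin (dim μ)) ℂ
  irreducible : ∀ μ, (matrixRep (irrep μ)).IsIrreducible
  inequivalent : ∀ μ ν, μ ≠ ν → IsEmpty ((matrixRep (irrep μ)).Equiv (matrixRep (irrep ν)))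
  /-- the vectors `e_i ⊗ f_a` of `M_μ ⊗ N_μ` -/
  basis : OrthonormalBasis (Σ μ, Fin (dim μ) × Fin (mult μ)) ℂ H
  /-- `U(g) (e_i ⊗ f_a) = (U_μ(g) e_i) ⊗ f_a` -/
  map_basis : ∀ g μ i a, U g (basis ⟨μ, (i, a)⟩) =
    ∑ j, (irrep μ g : Matrix (Fin (dim μ)) (Fin (dim μ)) ℂ) j i • basis ⟨μ, (j, a)⟩

namespace IrrepDecomposition

variable {U : G →* (H ≃ₗᵢ[ℂ] H)} (D : IrrepDecomposition U)

/-- The component `Π_μ ψ` of `ψ`, as a vector of `M_μ ⊗ N_μ`. -/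
def component (ψ : H) (μ : Fin D.numIrreps) : Fin (D.dim μ) × Fin (D.mult μ) → ℂ :=
  fun p => D.basis.repr ψ ⟨μ, p⟩

/-- The reduction onto irreps `F^(μ) = tr_{N_μ} (Π_μ |ψ⟩⟨ψ| Π_μ)` of `ψ`. -/
def reduction (ψ : H) (μ : Fin D.numIrreps) : Matrix (Fin (D.dim μ)) (Fin (D.dim μ)) ℂ :=
  partialTraceRight (Matrix.vecMulVec (D.component ψ μ) (star (D.component ψ μ)))

/-- The `μ` component `χ_ψ^(μ)(g) = tr (U_μ(g) F^(μ))` of the characteristic function of `ψ`. -/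
def charFunComponent (ψ : H) (μ : Fin D.numIrreps) (g : G) : ℂ :=
  ((D.irrep μ g : Matrix (Fin (D.dim μ)) (Fin (D.dim μ)) ℂ) * D.reduction ψ μ).trace

open Classical in
/-- The irreps in which `ψ₁` or `ψ₂` has a nonzero component. -/
def jointSupport (ψ₁ ψ₂ : H) : Finset (Fin D.numIrreps) :=
  Finset.univ.filter fun μ => D.component ψ₁ μ ≠ 0 ∨ D.component ψ₂ μ ≠ 0

end IrrepDecomposition

/-- The characteristic function `χ_ψ(g) = ⟨ψ|U(g)|ψ⟩`. -/
def stateCharFun (U : G →* (H ≃ₗᵢ[ℂ] H)) (ψ : H) (g : G) : ℂ :=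
  inner ℂ ψ (U g ψ)

/-- `V` is a `G`-invariant unitary. -/
def IsGInvariant (U : G →* (H ≃ₗᵢ[ℂ] H)) (V : H ≃ₗᵢ[ℂ] H) : Prop :=
  ∀ g, V * U g = U g * V

end

/-! Write the component of a vector in `M_μ ⊗ N_μ` as a `d_μ × n_μ` matrix. Then `U(g)` multiplies
it on the left by `U_μ(g)`, the reduction of a state with matrix `A` is `A Aᴴ`, and right
multiplication by unitaries `W_μ` gives a `G`-invariant unitary `V`. With matrices `A_μ`, `B_μ` for
`ψ₁`, `ψ₂`, the overlap is the sum of the `tr (W_μ B_μᴴ A_μ)`, so this is Uhlmann's problem in each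
block: the polar decomposition gives a `W_μ` whose value is at least `tr (P Q)`, where `P`, `Q` are
the square roots of the two reductions (`exists_unitary_trace_ge`).

A Powers–Størmer argument (`Matrix.PosSemidef.trace_sub_le`) bounds `2 tr (P Q)` below by `tr P² +
tr Q² - d_μ δ_μ`, where `δ_μ` bounds every diagonal entry of `P² - Q²` in every orthonormal basis.
Summed over `μ`, the traces give `1 + 1`. Schur orthogonality inverts the Fourier transform and
yields `δ_μ = d_μ ∫ |χ₁ - χ₂|` (`norm_conj_apply_le`), hence the factor `d_μ²`. The unitaries depend
on the states alone, so one `V` serves both estimates.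

That a decomposition exists follows from complete reducibility and grouping equivalent irreducible
summands (`nonempty_irrepDecomposition`). -/

noncomputable section

/-! ### Polar decomposition, trace maximization and a Powers–Størmer inequality. -/

section MatrixInequalities

open Matrix
open scoped Matrix.Norms.L2Operator ComplexOrder MatrixOrder
variable {m n : Type*} [Fintype m] [Fintype n] [DecidableEq m] [DecidableEq n]

theorem norm_le_one_of_isHermitian_of_mul_self {E : Matrix m m ℂ} (hE : E.IsHermitian)
    (hEE : E * E = E) : ‖E‖ ≤ 1 := by
  have h : ‖E‖ = ‖E‖ * ‖E‖ := by
    have := l2_opNorm_conjTranspose_mul_self E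
    rwa [hE.eq, hEE] at this
  nlinarith [norm_nonneg E]

/-- Polar decomposition of a rectangular matrix, with a contraction as phase. -/
theorem exists_polar (A : Matrix m n ℂ) : ∃ (P : Matrix m m ℂ) (X : Matrix m n ℂ),
    P.PosSemidef ∧ P * P = A * Aᴴ ∧ A * Xᴴ = P ∧ ‖X‖ ≤ 1 := by
  have hF : (A * Aᴴ).PosSemidef := posSemidef_self_mul_conjTranspose A
  set V : Matrix m m ℂ := (hF.isHermitian.eigenvectorUnitary : Matrix m m ℂ) with hV
  have hVV : Vᴴ * V = 1 := by
    rw [← star_eq_conjTranspose]; exact Unitary.coe_star_mul_self _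
  set l := hF.isHermitian.eigenvalues with hl
  have hl0 : ∀ i, 0 ≤ l i := hF.eigenvalues_nonneg
  -- Functional calculus of `A Aᴴ`: `f` prescribes the values on a fixed eigenbasis.
  let c (f : m → ℝ) : Matrix m m ℂ := V * diagonal (fun i => (f i : ℂ)) * Vᴴ
  have hc (f g : m → ℝ) : c f * c g = c (fun i => f i * g i) := by
    simp only [c]
    rw [show V * diagonal (fun i => (f i : ℂ)) * Vᴴ * (V * diagonal (fun i => (g i : ℂ)) * Vᴴ)
      = V * (diagonal (fun i => (f i : ℂ)) * (Vᴴ * V) * diagonal (fun i => (g i : ℂ))) * Vᴴ by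
        simp only [Matrix.mul_assoc], hVV, Matrix.mul_one, diagonal_mul_diagonal]
    simp
  have hcH (f : m → ℝ) : (c f)ᴴ = c f := by
    simp only [c, conjTranspose_mul, conjTranspose_conjTranspose, diagonal_conjTranspose,
      Matrix.mul_assoc]
    congr 3
    ext i
    simp
  have hspec : A * Aᴴ = c l := by
    have := hF.isHermitian.spectral_theorem
    rw [Unitary.conjStarAlgAut_apply] at this
    rw [this]
    rfl
  -- `X` is `(A Aᴴ)^(-1/2) A`. Since `0⁻¹ = 0`, the inverse root is a pseudo-inverse, vanishing on
  -- the kernel.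
  refine ⟨c fun i => √(l i), c (fun i => (√(l i))⁻¹) * A, ?_, ?_, ?_, ?_⟩
  · refine PosSemidef.mul_mul_conjTranspose_same (PosSemidef.diagonal fun i => ?_) V
    exact Complex.zero_le_real.2 (Real.sqrt_nonneg _)
  · rw [hc, hspec]
    congr 1
    funext i
    exact Real.mul_self_sqrt (hl0 i)
  · rw [conjTranspose_mul, hcH, ← Matrix.mul_assoc, hspec, hc]
    congr 1
    funext i
    rcases (hl0 i).eq_or_lt with h | h
    · simp [← h]
    · rw [← div_eq_mul_inv, Real.div_sqrt]
  -- `X Xᴴ` is the projection onto the eigenvectors with nonzero eigenvalue.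
  · have key : ‖(c (fun i => (√(l i))⁻¹) * A) * (c (fun i => (√(l i))⁻¹) * A)ᴴ‖ ≤ 1 := by
      rw [conjTranspose_mul, hcH, Matrix.mul_assoc, ← Matrix.mul_assoc A, hspec, hc, hc]
      refine norm_le_one_of_isHermitian_of_mul_self (hcH _) ?_
      rw [hc]
      congr 1
      funext i
      rcases (hl0 i).eq_or_lt with h | h
      · simp [← h]
      · have := Real.mul_self_sqrt (hl0 i)
        have h' := Real.sqrt_pos.2 h
        rw [show (√(l i))⁻¹ * (l i * (√(l i))⁻¹) = 1 by
          rw [← div_eq_mul_inv, Real.div_sqrt]; exact inv_mul_cancel₀ h'.ne', one_mul]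
    have h2 := l2_opNorm_conjTranspose_mul_self (c (fun i => (√(l i))⁻¹) * A)ᴴ
    rw [conjTranspose_conjTranspose, l2_opNorm_conjTranspose] at h2
    rw [h2] at key
    nlinarith [norm_nonneg (c (fun i => (√(l i))⁻¹) * A)]

theorem norm_star_dotProduct_mulVec_le {Z : Matrix n n ℂ} (hZ : ‖Z‖ ≤ 1) (x : n → ℂ) :
    ‖star x ⬝ᵥ (Z *ᵥ x)‖ ≤ (star x ⬝ᵥ x).re := by
  have h := norm_inner_le_norm (𝕜 := ℂ) (WithLp.toLp 2 x) (WithLp.toLp 2 (Z *ᵥ x))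
  have h2 := l2_opNorm_mulVec Z (WithLp.toLp 2 x)
  have h3 := inner_self_eq_norm_sq (𝕜 := ℂ) (WithLp.toLp 2 x)
  rw [EuclideanSpace.inner_eq_star_dotProduct] at h h3
  simp only at h h2 h3
  rw [dotProduct_comm, dotProduct_comm _ x]
  refine h.trans ?_
  change RCLike.re _ = _ at h3
  rw [← RCLike.re_eq_complex_re, h3, sq]
  gcongr
  exact h2.trans (mul_le_of_le_one_left (norm_nonneg _) hZ)

/-- With `R = Cᴴ C`, the trace becomes a sum of quadratic forms of `Z` at the columns of `Cᴴ`, to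
each of which Cauchy–Schwarz applies. -/
theorem Matrix.PosSemidef.norm_trace_mul_le {R Z : Matrix n n ℂ} (hR : R.PosSemidef)
    (hZ : ‖Z‖ ≤ 1) : ‖(R * Z).trace‖ ≤ R.trace.re := by
  obtain ⟨C, rfl⟩ := CStarAlgebra.nonneg_iff_eq_star_mul_self.mp hR.nonneg
  have h1 (Y : Matrix n n ℂ) : (star C * C * Y).trace = ∑ i, star (Cᴴ.col i) ⬝ᵥ (Y *ᵥ Cᴴ.col i) := by
    rw [star_eq_conjTranspose, Matrix.mul_assoc, trace_mul_comm, trace]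
    refine Finset.sum_congr rfl fun i _ => ?_
    rw [dotProduct_mulVec]
    simp [Matrix.mul_apply, dotProduct, vecMul]
  have h2 := h1 1
  rw [Matrix.mul_one] at h2
  rw [h1, h2, Complex.re_sum]
  refine norm_sum_le_of_le _ fun i _ => ?_
  rw [one_mulVec]
  exact norm_star_dotProduct_mulVec_le hZ _

/-- For a square matrix `M` some unitary `W` maximizes `|tr (Z M)|` over all contractions `Z`. -/
theorem exists_unitary_trace_max (M : Matrix n n ℂ) : ∃ W ∈ unitaryGroup n ℂ,
    ∀ Z : Matrix n n ℂ, ‖Z‖ ≤ 1 → ‖(M * Z).trace‖ ≤ (W * M).trace.re := by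
  obtain ⟨R, X, hR, hRR, hX, -⟩ := exists_polar Mᴴ
  rw [conjTranspose_conjTranspose] at hRR
  have hXM : X * M = R := by
    have := congrArg conjTranspose hX
    rwa [conjTranspose_mul, conjTranspose_conjTranspose, conjTranspose_conjTranspose,
      hR.isHermitian.eq] at this
  let e := toEuclideanCLM (n := n) (𝕜 := ℂ)
  -- The contraction `X` need not be unitary, but `R² = Mᴴ M` makes it isometric on the range of
  -- `M`. In finite dimension it extends from there to a unitary `W` with `W M = R`.
  have hnorm (v : EuclideanSpace ℂ n) : ‖e X (e M v)‖ = ‖e M v‖ := by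
    rw [← ContinuousLinearMap.comp_apply, ← ContinuousLinearMap.mul_def, ← map_mul, hXM]
    rw [← sq_eq_sq₀ (norm_nonneg _) (norm_nonneg _),
      ContinuousLinearMap.apply_norm_sq_eq_inner_adjoint_left,
      ContinuousLinearMap.apply_norm_sq_eq_inner_adjoint_left]
    have h1 : ContinuousLinearMap.adjoint (e R) ∘L e R
        = ContinuousLinearMap.adjoint (e M) ∘L e M := by
      rw [← ContinuousLinearMap.star_eq_adjoint, ← ContinuousLinearMap.star_eq_adjoint]
      change star (e R) * e R = star (e M) * e M
      rw [← map_star, ← map_star, ← map_mul, ← map_mul, star_eq_conjTranspose,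
        star_eq_conjTranspose, hR.isHermitian.eq, hRR]
    rw [h1]
  let S : Submodule ℂ (EuclideanSpace ℂ n) := LinearMap.range (e M).toLinearMap
  let L : S →ₗᵢ[ℂ] EuclideanSpace ℂ n :=
    { toLinearMap := (e X).toLinearMap ∘ₗ S.subtype
      norm_map' := by
        rintro ⟨_, v, rfl⟩
        exact hnorm v }
  let K : EuclideanSpace ℂ n →L[ℂ] EuclideanSpace ℂ n := L.extend.toContinuousLinearMap
  have hK : star K * K = 1 :=
    (ContinuousLinearMap.norm_map_iff_adjoint_comp_self K).1 L.extend.norm_map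
  have hKM : K * e M = e R := by
    ext1 v
    rw [← hXM, map_mul]
    exact L.extend_apply ⟨e M v, v, rfl⟩
  obtain ⟨W, hWK⟩ : ∃ W, e W = K := EquivLike.surjective e K
  have hW : star W * W = 1 := by
    apply EquivLike.injective e
    rw [map_mul, map_star, map_one, hWK, hK]
  have hWM : W * M = R := by
    apply EquivLike.injective e
    rw [map_mul, hWK, hKM]
  refine ⟨W, mem_unitaryGroup_iff'.2 hW, fun Z hZ => ?_⟩
  -- Cyclicity gives `tr (M Z) = tr (R Z Wᴴ)`, where `Z Wᴴ` is again a contraction.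
  have hM : M = star W * R := by rw [← hWM, ← Matrix.mul_assoc, hW, Matrix.one_mul]
  rw [hWM]
  conv_lhs => rw [hM, Matrix.mul_assoc, trace_mul_comm, Matrix.mul_assoc]
  refine hR.norm_trace_mul_le ((norm_mul_le _ _).trans ?_)
  have hn : ‖star W‖ ≤ 1 := by
    have h1 : ‖(1 : Matrix n n ℂ)‖ ≤ 1 :=
      norm_le_one_of_isHermitian_of_mul_self isHermitian_one (Matrix.mul_one _)
    rw [← hW, CStarRing.norm_star_mul_self] at h1
    rw [norm_star]
    nlinarith [norm_nonneg W]
  exact mul_le_one₀ hZ (norm_nonneg _) hn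

/-- A Powers–Størmer type inequality. -/
theorem Matrix.PosSemidef.trace_sub_le {P Q : Matrix m m ℂ} (hP : P.PosSemidef)
    (hQ : Q.PosSemidef) {δ : ℝ}
    (hδ : ∀ V ∈ unitaryGroup m ℂ, ∀ i, ‖(Vᴴ * (P * P - Q * Q) * V) i i‖ ≤ δ) :
    (P * P).trace.re + (Q * Q).trace.re - Fintype.card m * δ ≤ 2 * (P * Q).trace.re := by
  have hD : (P - Q).IsHermitian := hP.isHermitian.sub hQ.isHermitian
  set V : Matrix m m ℂ := (hD.eigenvectorUnitary : Matrix m m ℂ) with hV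
  have hVm : V ∈ unitaryGroup m ℂ := hD.eigenvectorUnitary.2
  have hVV : V * Vᴴ = 1 := mem_unitaryGroup_iff.1 hVm
  have hVV' : Vᴴ * V = 1 := mem_unitaryGroup_iff'.1 hVm
  set l := hD.eigenvalues with hl
  have hPV := hP.conjTranspose_mul_mul_same V
  have hQV := hQ.conjTranspose_mul_mul_same V
  set P' := Vᴴ * P * V with hP'
  set Q' := Vᴴ * Q * V with hQ'
  have hmul (A B : Matrix m m ℂ) : Vᴴ * A * V * (Vᴴ * B * V) = Vᴴ * (A * B) * V := by
    rw [show Vᴴ * A * V * (Vᴴ * B * V) = Vᴴ * A * (V * Vᴴ) * B * V by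
      simp only [Matrix.mul_assoc], hVV]
    simp only [Matrix.mul_assoc, Matrix.mul_one]
  have htr (A : Matrix m m ℂ) : (Vᴴ * A * V).trace = A.trace := by
    rw [trace_mul_comm, ← Matrix.mul_assoc, hVV, Matrix.one_mul]
  have hdiag : P' = Q' + diagonal (fun i => (l i : ℂ)) := by
    have := hD.spectral_theorem
    rw [Unitary.conjStarAlgAut_apply] at this
    have h2 : Vᴴ * (P - Q) * V = diagonal (fun i => (l i : ℂ)) := by
      rw [this]
      change Vᴴ * (V * _ * Vᴴ) * V = _
      rw [show ∀ B : Matrix m m ℂ, Vᴴ * (V * B * Vᴴ) * V = (Vᴴ * V) * B * (Vᴴ * V) by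
        intro B; simp only [Matrix.mul_assoc], hVV', Matrix.one_mul, Matrix.mul_one]
      rfl
    rw [← h2, Matrix.mul_sub, Matrix.sub_mul]
    abel
  -- In an eigenbasis of `P - Q`, the `i`-th diagonal entry of `P² - Q²` is `l i * (P' i i + Q' i
  -- i)`, and `|l i| = |P' i i - Q' i i|` is at most that sum of nonnegative entries.
  have hδ' (i : m) : (l i) ^ 2 ≤ δ := by
    refine le_trans ?_ (hδ V hVm i)
    have h1 : Vᴴ * (P * P - Q * Q) * V = P' * P' - Q' * Q' := by
      rw [hP', hQ', hmul, hmul, Matrix.mul_sub, Matrix.sub_mul]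
    have h2 : (P' * P' - Q' * Q') i i = l i * (P' i i + Q' i i) := by
      rw [hdiag]
      simp [Matrix.add_mul, Matrix.mul_add]
      ring
    have hPi := hPV.diag_nonneg (i := i)
    have hQi := hQV.diag_nonneg (i := i)
    have h3 : P' i i = Q' i i + l i := by rw [hdiag]; simp
    have hPr := (Complex.nonneg_iff.1 hPi).1
    have hQr := (Complex.nonneg_iff.1 hQi).1
    have h4 : (P' i i).re = (Q' i i).re + l i := by simpa using congrArg Complex.re h3
    rw [h1, h2, norm_mul, Complex.norm_real, Real.norm_eq_abs, ← sq_abs, sq]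
    refine mul_le_mul_of_nonneg_left (le_trans ?_ (Complex.re_le_norm _)) (abs_nonneg _)
    rw [Complex.add_re, abs_le]
    constructor <;> linarith
  have hsum : (P * P).trace.re + (Q * Q).trace.re - 2 * (P * Q).trace.re = ∑ i, (l i) ^ 2 := by
    have h1 : ((P - Q) * (P - Q)).trace = ∑ i, (l i : ℂ) ^ 2 := by
      rw [← htr, ← hmul, Matrix.mul_sub, Matrix.sub_mul, ← hP', ← hQ', hdiag, add_sub_cancel_left,
        diagonal_mul_diagonal, trace_diagonal]
      simp [sq]
    have h2 := congrArg Complex.re h1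
    rw [Matrix.sub_mul, Matrix.mul_sub, Matrix.mul_sub, trace_sub, trace_sub, trace_sub,
      trace_mul_comm Q P] at h2
    simp only [Complex.sub_re] at h2
    rw [show (∑ i, (l i : ℂ) ^ 2) = ((∑ i, (l i) ^ 2 : ℝ) : ℂ) by push_cast; rfl,
      Complex.ofReal_re] at h2
    linarith
  have hle : ∑ i, (l i) ^ 2 ≤ Fintype.card m * δ := by
    refine (Finset.sum_le_card_nsmul _ _ _ fun i _ => hδ' i).trans ?_
    simp
  linarith

/-- A unitary on the multiplicity space bringing the purifications `A`, `B` close to each other. -/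
theorem exists_unitary_trace_ge (A B : Matrix m n ℂ) : ∃ W ∈ unitaryGroup n ℂ,
    ∀ δ : ℝ,
    (∀ V ∈ unitaryGroup m ℂ, ∀ i, ‖(Vᴴ * (A * Aᴴ - B * Bᴴ) * V) i i‖ ≤ δ) →
    (A * Aᴴ).trace.re + (B * Bᴴ).trace.re - Fintype.card m * δ
      ≤ 2 * (W * (Bᴴ * A)).trace.re := by
  obtain ⟨P, X, hP, hPP, hX, hX1⟩ := exists_polar A
  obtain ⟨Q, Y, hQ, hQQ, hY, hY1⟩ := exists_polar B
  obtain ⟨W, hW, hmax⟩ := exists_unitary_trace_max (Bᴴ * A)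
  -- `W` is fixed before `δ`, so different bounds can be used with the same unitary.
  refine ⟨W, hW, fun δ hδ => ?_⟩
  rw [← hPP, ← hQQ] at hδ ⊢
  refine (hP.trace_sub_le hQ hδ).trans ?_
  have hYB : Y * Bᴴ = Q := by
    have := congrArg conjTranspose hY
    rwa [conjTranspose_mul, conjTranspose_conjTranspose, hQ.isHermitian.eq] at this
  -- `Xᴴ Y` is a contraction competing in the maximum attained by `W`; its value is `tr (P Q)`.
  have htr : (P * Q).trace = (Bᴴ * A * (Xᴴ * Y)).trace := by
    rw [← hX, ← hYB, Matrix.mul_assoc Bᴴ, trace_mul_comm Bᴴ]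
    simp only [Matrix.mul_assoc]
  have h := hmax (Xᴴ * Y) ((l2_opNorm_mul _ _).trans
    (mul_le_one₀ ((l2_opNorm_conjTranspose X).trans_le hX1) (norm_nonneg _) hY1))
  rw [← htr] at h
  linarith [Complex.re_le_norm (P * Q).trace]

end MatrixInequalities

open MeasureTheory Matrix

/-! ### Schur's lemma and orthogonality of matrix coefficients. -/

section Schur
variable {G : Type*} [Group G] {d e : ℕ} {π : G →* unitaryGroup (Fin d) ℂ}
  {σ : G →* unitaryGroup (Fin e) ℂ}

/-- A matrix intertwining two matrix representations, as an intertwining map. -/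
def intertwiningMapOfMatrix (X : Matrix (Fin e) (Fin d) ℂ)
    (hX : ∀ g, X * (π g : Matrix (Fin d) (Fin d) ℂ) = (σ g : Matrix (Fin e) (Fin e) ℂ) * X) :
    (matrixRep π).IntertwiningMap (matrixRep σ) where
  toLinearMap := toLin' X
  isIntertwining' g := by
    change toLin' X ∘ₗ toLin' _ = toLin' _ ∘ₗ toLin' X
    rw [← toLin'_mul, ← toLin'_mul, hX]

theorem eq_zero_of_intertwines (hπ : (matrixRep π).IsIrreducible)
    (hσ : (matrixRep σ).IsIrreducible) (hne : IsEmpty ((matrixRep π).Equiv (matrixRep σ)))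
    {X : Matrix (Fin e) (Fin d) ℂ}
    (hX : ∀ g, X * (π g : Matrix (Fin d) (Fin d) ℂ) = (σ g : Matrix (Fin e) (Fin e) ℂ) * X) :
    X = 0 := by
  -- The `Subsingleton` instance is Schur's lemma for inequivalent irreps.
  have h : intertwiningMapOfMatrix X hX = 0 := Subsingleton.elim _ _
  have h2 : toLin' X = 0 := congrArg (fun f => f.toLinearMap) h
  simpa using h2

theorem eq_smul_one_of_commutes (hπ : (matrixRep π).IsIrreducible) {X : Matrix (Fin d) (Fin d) ℂ}
    (hX : ∀ g, X * (π g : Matrix (Fin d) (Fin d) ℂ) = (π g : Matrix (Fin d) (Fin d) ℂ) * X) :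
    ∃ c : ℂ, X = c • (1 : Matrix (Fin d) (Fin d) ℂ) := by
  obtain ⟨c, hc⟩ :=
    (Representation.IsIrreducible.algebraMap_intertwiningMap_bijective_of_isAlgClosed
      (ρ := matrixRep π)).2 (intertwiningMapOfMatrix X hX)
  refine ⟨c, ?_⟩
  have h2 : toLin' (c • (1 : Matrix (Fin d) (Fin d) ℂ)) = toLin' X := by
    rw [map_smul, toLin'_one]
    exact congrArg (fun f => f.toLinearMap) hc
  exact (toLin'.injective h2).symm

theorem dim_pos_of_isIrreducible (hπ : (matrixRep π).IsIrreducible) : 0 < d := by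
  rcases Nat.eq_zero_or_pos d with rfl | h
  · exfalso
    obtain ⟨x, y, hxy⟩ := hπ.toNontrivial
    refine hxy (SetLike.ext fun v => ?_)
    rw [Subsingleton.elim v 0]
    exact iff_of_true x.toSubmodule.zero_mem y.toSubmodule.zero_mem
  · exact h

variable [TopologicalSpace G] [CompactSpace G] [MeasurableSpace G] [BorelSpace G]
  (haar : Measure G) [haar.IsHaarMeasure]

theorem integrable_of_continuous {f : G → ℂ} (hf : Continuous f) : Integrable f haar :=
  hf.integrable_of_hasCompactSupport (HasCompactSupport.of_compactSpace f)

variable [IsTopologicalGroup G]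

/-- The matrix `∫ σ(g) E_{jl} π(g)^* dg` intertwines `π` and `σ`. -/
theorem haar_average_intertwines
    (hπ : ∀ i j, Continuous fun g => (π g : Matrix (Fin d) (Fin d) ℂ) i j)
    (hσ : ∀ i j, Continuous fun g => (σ g : Matrix (Fin e) (Fin e) ℂ) i j)
    (j : Fin e) (l : Fin d) (h : G) :
    (Matrix.of fun i k => ∫ g, (σ g : Matrix (Fin e) (Fin e) ℂ) i j *
      star ((π g : Matrix (Fin d) (Fin d) ℂ) k l) ∂haar) * (π h : Matrix (Fin d) (Fin d) ℂ) =
    (σ h : Matrix (Fin e) (Fin e) ℂ) * (Matrix.of fun i k =>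
      ∫ g, (σ g : Matrix (Fin e) (Fin e) ℂ) i j *
      star ((π g : Matrix (Fin d) (Fin d) ℂ) k l) ∂haar) := by
  have hint (i : Fin e) (k : Fin d) : Integrable (fun g => (σ g : Matrix (Fin e) (Fin e) ℂ) i j *
      star ((π g : Matrix (Fin d) (Fin d) ℂ) k l)) haar :=
    integrable_of_continuous haar ((hσ i j).mul (hπ k l).star)
  have hinv (p k : Fin d) : star ((π h⁻¹ : Matrix (Fin d) (Fin d) ℂ) k p) =
      (π h : Matrix (Fin d) (Fin d) ℂ) p k := by
    rw [map_inv, UnitaryGroup.inv_apply]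
    simp [star_apply]
  ext i k
  simp only [Matrix.mul_apply, of_apply]
  calc ∑ p, (∫ g, (σ g : Matrix (Fin e) (Fin e) ℂ) i j *
        star ((π g : Matrix (Fin d) (Fin d) ℂ) p l) ∂haar) * (π h : Matrix (Fin d) (Fin d) ℂ) p k
      = ∫ g, (σ g : Matrix (Fin e) (Fin e) ℂ) i j *
        star ((π (h⁻¹ * g) : Matrix (Fin d) (Fin d) ℂ) k l) ∂haar := by
        simp_rw [← integral_mul_const]
        rw [← integral_finsetSum _ fun p _ => (hint i p).mul_const _]
        congr 1
        funext g
        rw [map_mul, UnitaryGroup.mul_val, Matrix.mul_apply, star_sum, Finset.mul_sum]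
        refine Finset.sum_congr rfl fun p _ => ?_
        rw [star_mul', hinv]
        ring
    _ = ∫ g, (σ (h * g) : Matrix (Fin e) (Fin e) ℂ) i j *
        star ((π g : Matrix (Fin d) (Fin d) ℂ) k l) ∂haar := by
        -- Left invariance of Haar measure: substitute `g ↦ h g`.
        rw [← integral_mul_left_eq_self _ h]
        simp only [inv_mul_cancel_left]
    _ = _ := by
        simp_rw [← integral_const_mul]
        rw [← integral_finsetSum _ fun p _ => (hint p k).const_mul _]
        congr 1
        funext g
        rw [map_mul, UnitaryGroup.mul_val, Matrix.mul_apply, Finset.sum_mul]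
        refine Finset.sum_congr rfl fun p _ => ?_
        ring

theorem schur_orthogonality_of_inequivalent (hπi : (matrixRep π).IsIrreducible)
    (hσi : (matrixRep σ).IsIrreducible) (hne : IsEmpty ((matrixRep π).Equiv (matrixRep σ)))
    (hπ : ∀ i j, Continuous fun g => (π g : Matrix (Fin d) (Fin d) ℂ) i j)
    (hσ : ∀ i j, Continuous fun g => (σ g : Matrix (Fin e) (Fin e) ℂ) i j)
    (i j : Fin e) (k l : Fin d) :
    ∫ g, (σ g : Matrix (Fin e) (Fin e) ℂ) i j *
      star ((π g : Matrix (Fin d) (Fin d) ℂ) k l) ∂haar = 0 :=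
  congrFun₂ (eq_zero_of_intertwines hπi hσi hne (haar_average_intertwines haar hπ hσ j l)) i k

/-- The averaged matrix unit is a scalar `c`; taking traces and using unitarity of `π g` gives `c d
= δ_{jl}`. -/
theorem schur_orthogonality [IsProbabilityMeasure haar] (hπi : (matrixRep π).IsIrreducible)
    (hπ : ∀ i j, Continuous fun g => (π g : Matrix (Fin d) (Fin d) ℂ) i j)
    (i j k l : Fin d) :
    d * ∫ g, (π g : Matrix (Fin d) (Fin d) ℂ) i j *
      star ((π g : Matrix (Fin d) (Fin d) ℂ) k l) ∂haar = if i = k ∧ j = l then 1 else 0 := by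
  obtain ⟨c, hc⟩ := eq_smul_one_of_commutes hπi (haar_average_intertwines haar hπ hπ j l)
  have hcd : c * d = if j = l then 1 else 0 := by
    have h1 := congrArg trace hc
    simp only [trace_smul, trace_one, Fintype.card_fin, smul_eq_mul] at h1
    rw [← h1]
    simp only [trace, diag_apply, of_apply]
    have hint (p : Fin d) : Integrable (fun g => (π g : Matrix (Fin d) (Fin d) ℂ) p j *
        star ((π g : Matrix (Fin d) (Fin d) ℂ) p l)) haar :=
      integrable_of_continuous haar ((hπ p j).mul (hπ p l).star)
    rw [← integral_finsetSum _ fun p _ => hint p]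
    have h2 (g : G) : ∑ p, (π g : Matrix (Fin d) (Fin d) ℂ) p j *
        star ((π g : Matrix (Fin d) (Fin d) ℂ) p l) = if j = l then 1 else 0 := by
      have h3 := congrFun₂ (mem_unitaryGroup_iff'.1 (π g).2) l j
      rw [Matrix.mul_apply, Matrix.one_apply] at h3
      rw [if_congr (eq_comm (a := j)) rfl rfl, ← h3]
      refine Finset.sum_congr rfl fun p _ => ?_
      rw [star_apply, mul_comm]
    simp_rw [h2]
    simp
  have hik := congrFun₂ hc i k
  rw [of_apply, Matrix.smul_apply, Matrix.one_apply] at hik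
  rw [hik, smul_eq_mul, ← mul_assoc, mul_comm (d : ℂ), hcd]
  by_cases h1 : i = k <;> by_cases h2 : j = l <;> simp [h1, h2]

end Schur

/-! ### Fourier inversion on the irreps of a decomposition. -/

namespace IrrepDecomposition

variable {G : Type*} [Group G] {H : Type*} [NormedAddCommGroup H] [InnerProductSpace ℂ H]
  {U : G →* (H ≃ₗᵢ[ℂ] H)} (D : IrrepDecomposition U)

theorem irrep_apply (g : G) (μ : Fin D.numIrreps) (i j : Fin (D.dim μ)) (a : Fin (D.mult μ)) :
    (D.irrep μ g : Matrix (Fin (D.dim μ)) (Fin (D.dim μ)) ℂ) j i =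
      inner ℂ (D.basis ⟨μ, (j, a)⟩) (U g (D.basis ⟨μ, (i, a)⟩)) := by
  rw [D.map_basis, inner_sum, Finset.sum_eq_single j]
  · simp [inner_smul_right]
  · intro k _ hk
    rw [inner_smul_right, D.basis.inner_eq_ite, if_neg (by simpa using hk.symm), mul_zero]
  · simp

/-- Continuity passes from `U` to each irrep because its entries are matrix coefficients of `U`; a
nonzero multiplicity space supplies the vectors. -/
theorem continuous_irrep_apply [TopologicalSpace G] (hU : ∀ v : H, Continuous fun g => U g v)
    (μ : Fin D.numIrreps) (j i : Fin (D.dim μ)) :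
    Continuous fun g => (D.irrep μ g : Matrix (Fin (D.dim μ)) (Fin (D.dim μ)) ℂ) j i := by
  simp_rw [D.irrep_apply _ μ i j ⟨0, D.mult_pos μ⟩]
  exact continuous_const.inner (hU _)

variable [TopologicalSpace G] [CompactSpace G] [MeasurableSpace G] [BorelSpace G]
  [IsTopologicalGroup G] (haar : Measure G) [haar.IsHaarMeasure] [IsProbabilityMeasure haar]

/-- Fourier inversion: the matrices `F_ν` are recovered from `∑ ν, tr (U_ν(g) F_ν)`. -/
theorem fourier_inversion (hU : ∀ v : H, Continuous fun g => U g v)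
    (F : ∀ ν, Matrix (Fin (D.dim ν)) (Fin (D.dim ν)) ℂ) (μ : Fin D.numIrreps)
    (p q : Fin (D.dim μ)) :
    F μ p q = D.dim μ * ∫ g, (∑ ν, ((D.irrep ν g : Matrix (Fin (D.dim ν)) (Fin (D.dim ν)) ℂ) * F ν).trace) *
      star ((D.irrep μ g : Matrix (Fin (D.dim μ)) (Fin (D.dim μ)) ℂ) q p) ∂haar := by
  have hint (ν : Fin D.numIrreps) (a b : Fin (D.dim ν)) :
      Integrable (fun g => F ν b a * ((D.irrep ν g : Matrix (Fin (D.dim ν)) (Fin (D.dim ν)) ℂ) a b *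
        star ((D.irrep μ g : Matrix (Fin (D.dim μ)) (Fin (D.dim μ)) ℂ) q p))) haar :=
    (integrable_of_continuous haar ((D.continuous_irrep_apply hU ν a b).mul
      (D.continuous_irrep_apply hU μ q p).star)).const_mul _
  have h1 (g : G) : (∑ ν, ((D.irrep ν g : Matrix (Fin (D.dim ν)) (Fin (D.dim ν)) ℂ) * F ν).trace) *
      star ((D.irrep μ g : Matrix (Fin (D.dim μ)) (Fin (D.dim μ)) ℂ) q p) =
      ∑ ν, ∑ a, ∑ b, F ν b a * ((D.irrep ν g : Matrix (Fin (D.dim ν)) (Fin (D.dim ν)) ℂ) a b *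
        star ((D.irrep μ g : Matrix (Fin (D.dim μ)) (Fin (D.dim μ)) ℂ) q p)) := by
    rw [Finset.sum_mul]
    refine Finset.sum_congr rfl fun ν _ => ?_
    rw [trace, Finset.sum_mul]
    refine Finset.sum_congr rfl fun a _ => ?_
    rw [diag_apply, Matrix.mul_apply, Finset.sum_mul]
    refine Finset.sum_congr rfl fun b _ => ?_
    ring
  simp_rw [h1]
  rw [integral_finsetSum _ fun ν _ => integrable_finsetSum _ fun a _ =>
    integrable_finsetSum _ fun b _ => hint ν a b]
  rw [Finset.sum_eq_single μ]
  · rw [integral_finsetSum _ fun a _ => integrable_finsetSum _ fun b _ => hint μ a b]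
    simp_rw [integral_finsetSum _ fun b _ => hint μ _ b, integral_const_mul]
    simp_rw [Finset.mul_sum, mul_left_comm (D.dim μ : ℂ),
      schur_orthogonality haar (D.irreducible μ) (D.continuous_irrep_apply hU μ)]
    rw [Finset.sum_eq_single q, Finset.sum_eq_single p] <;> simp +contextual
  · intro ν _ hν
    rw [integral_finsetSum _ fun a _ => integrable_finsetSum _ fun b _ => hint ν a b]
    simp_rw [integral_finsetSum _ fun b _ => hint ν _ b, integral_const_mul,
      schur_orthogonality_of_inequivalent haar (D.irreducible μ) (D.irreducible ν)
        (D.inequivalent μ ν hν.symm) (D.continuous_irrep_apply hU μ)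
        (D.continuous_irrep_apply hU ν)]
    simp
  · simp

/-- Conjugating Fourier inversion by `V` expresses the entry as an integral against an entry of the
unitary `Vᴴ U_μ(g)ᴴ V`, which has modulus at most one. This supplies `δ` for the Powers–Størmer
bound. -/
theorem norm_conj_apply_le (hU : ∀ v : H, Continuous fun g => U g v)
    (F : ∀ ν, Matrix (Fin (D.dim ν)) (Fin (D.dim ν)) ℂ) (μ : Fin D.numIrreps)
    {V : Matrix (Fin (D.dim μ)) (Fin (D.dim μ)) ℂ} (hV : V ∈ unitaryGroup (Fin (D.dim μ)) ℂ)
    (i : Fin (D.dim μ)) :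
    ‖(Vᴴ * F μ * V) i i‖ ≤
      D.dim μ * ∫ g, ‖∑ ν, ((D.irrep ν g : Matrix (Fin (D.dim ν)) (Fin (D.dim ν)) ℂ) * F ν).trace‖ ∂haar := by
  let f (g : G) : ℂ := ∑ ν, ((D.irrep ν g : Matrix (Fin (D.dim ν)) (Fin (D.dim ν)) ℂ) * F ν).trace
  have hf : Continuous f := by
    refine continuous_finsetSum _ fun ν _ => continuous_finsetSum _ fun a _ => ?_
    simp only [diag_apply, Matrix.mul_apply]
    exact continuous_finsetSum _ fun b _ => (D.continuous_irrep_apply hU ν a b).mul_const _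
  have h1 : (Vᴴ * F μ * V) i i = D.dim μ * ∫ g, f g *
      (Vᴴ * (D.irrep μ g : Matrix (Fin (D.dim μ)) (Fin (D.dim μ)) ℂ)ᴴ * V) i i ∂haar := by
    have hint (p q : Fin (D.dim μ)) : Integrable (fun g => star (V q i) * V p i * (f g *
        star ((D.irrep μ g : Matrix (Fin (D.dim μ)) (Fin (D.dim μ)) ℂ) p q))) haar :=
      (integrable_of_continuous haar
        (hf.mul (D.continuous_irrep_apply hU μ p q).star)).const_mul _
    have h2 (g : G) : f g * (Vᴴ * (D.irrep μ g : Matrix (Fin (D.dim μ)) (Fin (D.dim μ)) ℂ)ᴴ * V) i i =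
        ∑ p, ∑ q, star (V q i) * V p i * (f g * star ((D.irrep μ g : Matrix (Fin (D.dim μ)) (Fin (D.dim μ)) ℂ) p q)) := by
      simp only [Matrix.mul_apply, conjTranspose_apply, Finset.mul_sum, Finset.sum_mul]
      refine Finset.sum_congr rfl fun p _ => Finset.sum_congr rfl fun q _ => ?_
      ring
    simp_rw [h2]
    rw [integral_finsetSum _ fun p _ => integrable_finsetSum _ fun q _ => hint p q]
    simp_rw [integral_finsetSum _ fun q _ => hint _ q, integral_const_mul, Finset.mul_sum,
      mul_left_comm (D.dim μ : ℂ), f, ← D.fourier_inversion haar hU F μ]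
    simp only [Matrix.mul_apply, conjTranspose_apply, Finset.sum_mul]
    refine Finset.sum_congr rfl fun p _ => Finset.sum_congr rfl fun q _ => ?_
    ring
  rw [h1, norm_mul, Complex.norm_natCast]
  refine mul_le_mul_of_nonneg_left (norm_integral_le_of_norm_le
    (integrable_of_continuous haar hf).norm (Filter.Eventually.of_forall fun g => ?_))
    (Nat.cast_nonneg _)
  rw [norm_mul]
  refine mul_le_of_le_one_right (norm_nonneg _) (entry_norm_bound_of_unitary ?_ i i)
  exact mul_mem (mul_mem (Unitary.star_mem hV) (Unitary.star_mem (D.irrep μ g).2)) hV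

end IrrepDecomposition

/-! ### States as coefficient matrices, invariant unitaries and overlaps. -/

namespace IrrepDecomposition

variable {G : Type*} [Group G] {H : Type*} [NormedAddCommGroup H] [InnerProductSpace ℂ H]
  {U : G →* (H ≃ₗᵢ[ℂ] H)} (D : IrrepDecomposition U)

/-- The component `Π_μ ψ` as a `d_μ × n_μ` matrix. -/
def coeffMatrix (ψ : H) (μ : Fin D.numIrreps) : Matrix (Fin (D.dim μ)) (Fin (D.mult μ)) ℂ :=
  Matrix.of fun i a => D.basis.repr ψ ⟨μ, (i, a)⟩

theorem ext_coeffMatrix {φ ψ : H} (h : ∀ μ, D.coeffMatrix φ μ = D.coeffMatrix ψ μ) : φ = ψ := by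
  apply D.basis.repr.injective
  ext ⟨μ, i, a⟩
  exact congrFun₂ (h μ) i a

theorem reduction_eq (ψ : H) (μ : Fin D.numIrreps) :
    D.reduction ψ μ = D.coeffMatrix ψ μ * (D.coeffMatrix ψ μ)ᴴ := by
  ext i j
  simp [reduction, partialTraceRight, coeffMatrix, component, Matrix.mul_apply, vecMulVec_apply]

theorem inner_eq_sum_trace (φ ψ : H) :
    inner ℂ φ ψ = ∑ μ, ((D.coeffMatrix φ μ)ᴴ * D.coeffMatrix ψ μ).trace := by
  rw [← D.basis.repr.inner_map_map, PiLp.inner_apply, Fintype.sum_sigma]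
  refine Finset.sum_congr rfl fun μ _ => ?_
  rw [Fintype.sum_prod_type_right]
  refine Finset.sum_congr rfl fun a _ => ?_
  rw [diag_apply, Matrix.mul_apply]
  refine Finset.sum_congr rfl fun i _ => ?_
  simp [coeffMatrix, mul_comm]

theorem coeffMatrix_map (g : G) (ψ : H) (μ : Fin D.numIrreps) :
    D.coeffMatrix (U g ψ) μ = (D.irrep μ g : Matrix (Fin (D.dim μ)) (Fin (D.dim μ)) ℂ) * D.coeffMatrix ψ μ := by
  ext j a
  conv_lhs => rw [← D.basis.sum_repr ψ]
  rw [coeffMatrix, of_apply, D.basis.repr_apply_apply, map_sum, inner_sum, Fintype.sum_sigma,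
    Finset.sum_eq_single μ]
  · rw [Fintype.sum_prod_type, Matrix.mul_apply]
    refine Finset.sum_congr rfl fun i _ => ?_
    rw [Finset.sum_eq_single a]
    · rw [map_smul, inner_smul_right, ← D.irrep_apply, mul_comm]
      rfl
    · intro b _ hb
      rw [map_smul, inner_smul_right, D.map_basis, inner_sum, Finset.sum_eq_zero, mul_zero]
      intro k _
      rw [inner_smul_right, D.basis.inner_eq_ite, if_neg (by simp [hb.symm]), mul_zero]
    · simp
  · intro ν _ hν
    refine Finset.sum_eq_zero fun p _ => ?_
    obtain ⟨i, b⟩ := p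
    rw [map_smul, inner_smul_right, D.map_basis, inner_sum, Finset.sum_eq_zero, mul_zero]
    intro k _
    rw [inner_smul_right, D.basis.inner_eq_ite, if_neg (by simp [hν.symm]), mul_zero]
  · simp

theorem stateCharFun_eq_sum (ψ : H) (g : G) :
    stateCharFun U ψ g = ∑ μ, D.charFunComponent ψ μ g := by
  rw [stateCharFun, D.inner_eq_sum_trace]
  refine Finset.sum_congr rfl fun μ _ => ?_
  rw [D.coeffMatrix_map, charFunComponent, reduction_eq, trace_mul_comm, Matrix.mul_assoc]

/-- The vector with given coefficient matrices. -/
def ofCoeff (A : ∀ μ, Matrix (Fin (D.dim μ)) (Fin (D.mult μ)) ℂ) : H :=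
  D.basis.repr.symm (WithLp.toLp 2 fun p => A p.1 p.2.1 p.2.2)

@[simp]
theorem coeffMatrix_ofCoeff (A : ∀ μ, Matrix (Fin (D.dim μ)) (Fin (D.mult μ)) ℂ)
    (μ : Fin D.numIrreps) : D.coeffMatrix (D.ofCoeff A) μ = A μ := by
  ext i a
  simp [coeffMatrix, ofCoeff]

theorem coeffMatrix_add (φ ψ : H) (μ : Fin D.numIrreps) :
    D.coeffMatrix (φ + ψ) μ = D.coeffMatrix φ μ + D.coeffMatrix ψ μ := by
  ext i a
  simp [coeffMatrix]

theorem coeffMatrix_smul (c : ℂ) (ψ : H) (μ : Fin D.numIrreps) :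
    D.coeffMatrix (c • ψ) μ = c • D.coeffMatrix ψ μ := by
  ext i a
  simp [coeffMatrix]

/-- Unitaries on the multiplicity spaces define an invariant unitary on `H`. -/
theorem exists_isGInvariant [FiniteDimensional ℂ H]
    (W : ∀ μ, Matrix (Fin (D.mult μ)) (Fin (D.mult μ)) ℂ)
    (hW : ∀ μ, W μ ∈ unitaryGroup (Fin (D.mult μ)) ℂ) :
    ∃ V : H ≃ₗᵢ[ℂ] H, IsGInvariant U V ∧
      ∀ ψ μ, D.coeffMatrix (V ψ) μ = D.coeffMatrix ψ μ * W μ := by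
  let T : H →ₗ[ℂ] H :=
    { toFun := fun ψ => D.ofCoeff fun μ => D.coeffMatrix ψ μ * W μ
      map_add' := fun φ ψ => D.ext_coeffMatrix fun μ => by
        simp [coeffMatrix_add, Matrix.add_mul]
      map_smul' := fun c ψ => D.ext_coeffMatrix fun μ => by
        simp [coeffMatrix_smul] }
  have hT (ψ : H) (μ : Fin D.numIrreps) : D.coeffMatrix (T ψ) μ = D.coeffMatrix ψ μ * W μ :=
    D.coeffMatrix_ofCoeff (fun μ => D.coeffMatrix ψ μ * W μ) μ
  have hin (φ ψ : H) : inner ℂ (T φ) (T ψ) = inner ℂ φ ψ := by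
    rw [D.inner_eq_sum_trace, D.inner_eq_sum_trace]
    refine Finset.sum_congr rfl fun μ _ => ?_
    rw [hT, hT, conjTranspose_mul, ← Matrix.mul_assoc, trace_mul_comm, ← Matrix.mul_assoc,
      ← Matrix.mul_assoc, show W μ * (W μ)ᴴ = 1 from mem_unitaryGroup_iff.1 (hW μ),
      Matrix.one_mul]
  -- An isometry between spaces of equal finite dimension is onto.
  let V : H ≃ₗᵢ[ℂ] H := (T.isometryOfInner hin).toLinearIsometryEquiv rfl
  refine ⟨V, fun g => ?_, hT⟩
  ext ψ
  refine D.ext_coeffMatrix fun μ => ?_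
  change D.coeffMatrix (T (U g ψ)) μ = D.coeffMatrix (U g (T ψ)) μ
  rw [hT, D.coeffMatrix_map, D.coeffMatrix_map, hT, Matrix.mul_assoc]

theorem sum_trace_re_eq_one {ψ : H} (hψ : ‖ψ‖ = 1) :
    ∑ μ, (D.coeffMatrix ψ μ * (D.coeffMatrix ψ μ)ᴴ).trace.re = 1 := by
  have h := inner_self_eq_norm_sq_to_K (𝕜 := ℂ) ψ
  rw [D.inner_eq_sum_trace, hψ] at h
  have h2 := congrArg Complex.re h
  rw [Complex.re_sum] at h2
  simp_rw [trace_mul_comm (D.coeffMatrix ψ _)]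
  simpa using h2

theorem coeffMatrix_eq_zero_of_notMem_jointSupport {ψ₁ ψ₂ : H} {μ : Fin D.numIrreps}
    (hμ : μ ∉ D.jointSupport ψ₁ ψ₂) : D.coeffMatrix ψ₁ μ = 0 ∧ D.coeffMatrix ψ₂ μ = 0 := by
  simp only [jointSupport, Finset.mem_filter, Finset.mem_univ, true_and, not_or, not_not] at hμ
  exact ⟨by ext i a; exact congrFun hμ.1 (i, a), by ext i a; exact congrFun hμ.2 (i, a)⟩

/-- There is an invariant unitary whose overlap is controlled by any bound on the diagonal entries
of the differences of the reductions. -/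
theorem exists_overlap_ge [FiniteDimensional ℂ H] {ψ₁ ψ₂ : H} (hψ₁ : ‖ψ₁‖ = 1)
    (hψ₂ : ‖ψ₂‖ = 1) : ∃ V : H ≃ₗᵢ[ℂ] H, IsGInvariant U V ∧
      ∀ δ : Fin D.numIrreps → ℝ,
        (∀ μ, ∀ X ∈ unitaryGroup (Fin (D.dim μ)) ℂ, ∀ i,
          ‖(Xᴴ * (D.reduction ψ₁ μ - D.reduction ψ₂ μ) * X) i i‖ ≤ δ μ) →
        1 - 1 / 2 * ∑ μ ∈ D.jointSupport ψ₁ ψ₂, D.dim μ * δ μ ≤ ‖inner ℂ ψ₂ (V ψ₁)‖ := by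
  choose W hW hge using fun μ => exists_unitary_trace_ge (D.coeffMatrix ψ₁ μ) (D.coeffMatrix ψ₂ μ)
  obtain ⟨V, hV, hVψ⟩ := D.exists_isGInvariant W hW
  refine ⟨V, hV, fun δ hδ => ?_⟩
  refine le_trans ?_ (Complex.re_le_norm _)
  rw [D.inner_eq_sum_trace, Complex.re_sum]
  simp_rw [hVψ, ← Matrix.mul_assoc, trace_mul_comm _ (W _)]
  -- Blocks outside the joint support vanish for both states and incur no error term, so only the
  -- joint support is summed.
  have h1 (μ : Fin D.numIrreps) :
      (D.coeffMatrix ψ₁ μ * (D.coeffMatrix ψ₁ μ)ᴴ).trace.re +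
        (D.coeffMatrix ψ₂ μ * (D.coeffMatrix ψ₂ μ)ᴴ).trace.re -
        (if μ ∈ D.jointSupport ψ₁ ψ₂ then D.dim μ * δ μ else 0) ≤
      2 * (W μ * ((D.coeffMatrix ψ₂ μ)ᴴ * D.coeffMatrix ψ₁ μ)).trace.re := by
    split_ifs with h
    · simpa using hge μ (δ μ) (by simpa only [reduction_eq] using hδ μ)
    · obtain ⟨h1, h2⟩ := D.coeffMatrix_eq_zero_of_notMem_jointSupport h
      simp [h1, h2]
  have h2 := Finset.sum_le_sum fun μ (_ : μ ∈ Finset.univ) => h1 μ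
  rw [Finset.sum_sub_distrib, Finset.sum_add_distrib, D.sum_trace_re_eq_one hψ₁,
    D.sum_trace_re_eq_one hψ₂, ← Finset.mul_sum, Finset.sum_ite_mem, Finset.univ_inter] at h2
  linarith

end IrrepDecomposition

/-- The two estimates are two choices of `δ` for the same `V`: Fourier inversion is applied to all
differences of reductions at once, or to a family concentrated at a single irrep. -/
theorem overlap_bounds {G : Type*} [Group G] [TopologicalSpace G] [IsTopologicalGroup G]
    [CompactSpace G] [MeasurableSpace G] [BorelSpace G]
    (haar : MeasureTheory.Measure G) [haar.IsHaarMeasure] [MeasureTheory.IsProbabilityMeasure haar]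
    {H : Type*} [NormedAddCommGroup H] [InnerProductSpace ℂ H] [FiniteDimensional ℂ H]
    {U : G →* (H ≃ₗᵢ[ℂ] H)} (hU : ∀ v : H, Continuous fun g => U g v)
    {ψ₁ ψ₂ : H} (hψ₁ : ‖ψ₁‖ = 1) (hψ₂ : ‖ψ₂‖ = 1) (D : IrrepDecomposition U) :
    ∃ V : H ≃ₗᵢ[ℂ] H, IsGInvariant U V ∧
      1 - 1 / 2 * (∑ μ ∈ D.jointSupport ψ₁ ψ₂, (D.dim μ : ℝ) ^ 2) *
          ∫ g, ‖stateCharFun U ψ₁ g - stateCharFun U ψ₂ g‖ ∂haar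
        ≤ ‖inner ℂ ψ₂ (V ψ₁)‖ ∧
      1 - 1 / 2 * ∑ μ ∈ D.jointSupport ψ₁ ψ₂, (D.dim μ : ℝ) ^ 2 *
          ∫ g, ‖D.charFunComponent ψ₁ μ g - D.charFunComponent ψ₂ μ g‖ ∂haar
        ≤ ‖inner ℂ ψ₂ (V ψ₁)‖ := by
  obtain ⟨V, hV, hge⟩ := D.exists_overlap_ge hψ₁ hψ₂
  have hcomp (μ : Fin D.numIrreps) (g : G) :
      D.charFunComponent ψ₁ μ g - D.charFunComponent ψ₂ μ g =
      ((D.irrep μ g : Matrix (Fin (D.dim μ)) (Fin (D.dim μ)) ℂ) * (D.reduction ψ₁ μ - D.reduction ψ₂ μ)).trace := by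
    rw [Matrix.mul_sub, trace_sub]
    rfl
  refine ⟨V, hV, ?_, ?_⟩
  · have h := hge (fun μ => D.dim μ * ∫ g, ‖stateCharFun U ψ₁ g - stateCharFun U ψ₂ g‖ ∂haar) ?_
    · refine le_trans (le_of_eq ?_) h
      rw [mul_assoc, Finset.sum_mul]
      simp only [sq, mul_assoc]
    · intro μ X hX i
      refine (D.norm_conj_apply_le haar hU
        (fun ν => D.reduction ψ₁ ν - D.reduction ψ₂ ν) μ hX i).trans (le_of_eq ?_)
      simp_rw [D.stateCharFun_eq_sum, ← Finset.sum_sub_distrib, hcomp]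
  · have h := hge (fun μ => D.dim μ *
      ∫ g, ‖D.charFunComponent ψ₁ μ g - D.charFunComponent ψ₂ μ g‖ ∂haar) ?_
    · refine le_trans (le_of_eq ?_) h
      simp only [sq, mul_assoc]
    · intro μ X hX i
      have h2 := D.norm_conj_apply_le haar hU
        (Pi.single μ (D.reduction ψ₁ μ - D.reduction ψ₂ μ)) μ hX i
      rw [Pi.single_eq_same] at h2
      refine h2.trans (le_of_eq ?_)
      congr 2
      funext g
      rw [hcomp, Finset.sum_eq_single μ]
      · rw [Pi.single_eq_same]
      · intro ν _ hν
        rw [Pi.single_eq_of_ne hν, Matrix.mul_zero, trace_zero]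
      · simp

/-! ### From equivalence to unitary equivalence. -/

section MatrixIntertwiner
variable {G : Type*} [Group G] {d e : ℕ} {π : G →* unitaryGroup (Fin d) ℂ}
  {σ : G →* unitaryGroup (Fin e) ℂ}

open scoped ComplexOrder in
/-- Equivalent irreducible unitary representations are unitarily equivalent. -/
theorem exists_unitary_intertwiner (hπ : (matrixRep π).IsIrreducible)
    (f : (matrixRep π).Equiv (matrixRep σ)) : ∃ T : Matrix (Fin e) (Fin d) ℂ,
    Tᴴ * T = 1 ∧ T * Tᴴ = 1 ∧
    ∀ g, T * (π g : Matrix (Fin d) (Fin d) ℂ) = (σ g : Matrix (Fin e) (Fin e) ℂ) * T := by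
  let X : Matrix (Fin e) (Fin d) ℂ := LinearMap.toMatrix' f.toLinearEquiv.toLinearMap
  have hX (g : G) : X * (π g : Matrix (Fin d) (Fin d) ℂ) =
      (σ g : Matrix (Fin e) (Fin e) ℂ) * X := by
    apply toLin'.injective
    rw [toLin'_mul, toLin'_mul, toLin'_toMatrix']
    exact f.toIntertwiningMap.isIntertwining' g
  have hX' (g : G) : Xᴴ * (σ g : Matrix (Fin e) (Fin e) ℂ) =
      (π g : Matrix (Fin d) (Fin d) ℂ) * Xᴴ := by
    have h := congrArg conjTranspose (hX g⁻¹)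
    rw [conjTranspose_mul, conjTranspose_mul, map_inv, map_inv, UnitaryGroup.inv_val,
      UnitaryGroup.inv_val, star_eq_conjTranspose, star_eq_conjTranspose,
      conjTranspose_conjTranspose, conjTranspose_conjTranspose] at h
    exact h.symm
  -- `Xᴴ` intertwines in the opposite direction, so `Xᴴ X` is a scalar. It is positive because `X`
  -- is injective on a nonzero space, and dividing `X` by its square root gives the unitary.
  obtain ⟨c, hc⟩ := eq_smul_one_of_commutes hπ (X := Xᴴ * X) fun g => by
    rw [Matrix.mul_assoc, hX, ← Matrix.mul_assoc, hX', Matrix.mul_assoc]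
  have hd := dim_pos_of_isIrreducible hπ
  have hc0 : 0 ≤ c := by
    have h := (posSemidef_conjTranspose_mul_self X).diag_nonneg (i := ⟨0, hd⟩)
    rw [hc] at h
    simpa using h
  have hcne : c ≠ 0 := by
    rintro rfl
    rw [zero_smul, conjTranspose_mul_self_eq_zero] at hc
    have h1 : f.toLinearEquiv.toLinearMap = 0 := by
      rw [← toLin'_toMatrix' f.toLinearEquiv.toLinearMap]
      change toLin' X = 0
      rw [hc, map_zero]
    have h2 : (Pi.single ⟨0, hd⟩ 1 : Fin d → ℂ) = 0 :=
      f.toLinearEquiv.injective (by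
        rw [map_zero]
        exact congrArg (fun l : (Fin d → ℂ) →ₗ[ℂ] (Fin e → ℂ) => l (Pi.single ⟨0, hd⟩ 1)) h1)
    simp at h2
  obtain ⟨r, hr, rfl⟩ : ∃ r : ℝ, 0 < r ∧ (r : ℂ) = c :=
    ⟨c.re, (Complex.lt_def.1 (lt_of_le_of_ne hc0 hcne.symm)).1,
      Complex.ext rfl (Complex.lt_def.1 (lt_of_le_of_ne hc0 hcne.symm)).2⟩
  have hde : d = e := by simpa using f.toLinearEquiv.finrank_eq
  have hT : (((√r)⁻¹ : ℝ) • X)ᴴ * (((√r)⁻¹ : ℝ) • X) = 1 := by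
    rw [conjTranspose_smul, Matrix.smul_mul, Matrix.mul_smul, hc, smul_smul, star_trivial,
      ← mul_inv, Real.mul_self_sqrt hr.le]
    ext i j
    by_cases h : i = j <;> simp [Matrix.one_apply, h, hr.ne']
  refine ⟨((√r)⁻¹ : ℝ) • X, hT, ?_, fun g => ?_⟩
  · exact (mul_eq_one_comm_of_card_eq _ _ _ (by simp [hde])).1 hT
  · rw [Matrix.smul_mul, Matrix.mul_smul, hX]

end MatrixIntertwiner

/-! ### Existence of a decomposition into irreps. -/

section Existence

variable {G : Type*} [Group G] {H : Type*} [NormedAddCommGroup H] [InnerProductSpace ℂ H]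

/-- `S` is invariant under the representation `U`. -/
def IsInvariantSubspace (U : G →* (H ≃ₗᵢ[ℂ] H)) (S : Submodule ℂ H) : Prop :=
  ∀ g, ∀ v ∈ S, U g v ∈ S

/-- `M` is a minimal nonzero invariant subspace. -/
structure IsIrreducibleSubspace (U : G →* (H ≃ₗᵢ[ℂ] H)) (M : Submodule ℂ H) : Prop where
  invariant : IsInvariantSubspace U M
  ne_bot : M ≠ ⊥
  minimal : ∀ N ≤ M, IsInvariantSubspace U N → N ≠ ⊥ → N = M

theorem inner_map_left (U : G →* (H ≃ₗᵢ[ℂ] H)) (g : G) (v w : H) :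
    inner ℂ (U g v) w = inner ℂ v (U g⁻¹ w) := by
  rw [← (U g⁻¹).inner_map_map]
  congr 1
  change (U g⁻¹ * U g) v = v
  rw [← map_mul, inv_mul_cancel, map_one]
  rfl

theorem IsInvariantSubspace.orthogonal {U : G →* (H ≃ₗᵢ[ℂ] H)} {S : Submodule ℂ H}
    (hS : IsInvariantSubspace U S) : IsInvariantSubspace U Sᗮ := by
  intro g v hv
  rw [Submodule.mem_orthogonal'] at hv ⊢
  intro u hu
  rw [inner_map_left]
  exact hv _ (hS _ _ hu)

theorem IsInvariantSubspace.inf {U : G →* (H ≃ₗᵢ[ℂ] H)} {S T : Submodule ℂ H}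
    (hS : IsInvariantSubspace U S) (hT : IsInvariantSubspace U T) :
    IsInvariantSubspace U (S ⊓ T) :=
  fun g v hv => ⟨hS g v hv.1, hT g v hv.2⟩

theorem exists_isIrreducibleSubspace_le [FiniteDimensional ℂ H] {U : G →* (H ≃ₗᵢ[ℂ] H)} {S : Submodule ℂ H}
    (hS : IsInvariantSubspace U S) (hS0 : S ≠ ⊥) : ∃ M ≤ S, IsIrreducibleSubspace U M := by
  obtain ⟨M, ⟨hMS, hM, hM0⟩, hmin⟩ := wellFounded_lt.has_min
    {N : Submodule ℂ H | N ≤ S ∧ IsInvariantSubspace U N ∧ N ≠ ⊥} ⟨S, le_rfl, hS, hS0⟩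
  exact ⟨M, hMS, hM, hM0, fun N hN hNi hN0 =>
    by_contra fun h => hmin N ⟨hN.trans hMS, hNi, hN0⟩ (lt_of_le_of_ne hN h)⟩

open Classical in
/-- An invariant subspace is an orthogonal sum of irreducible ones. -/
theorem exists_orthogonal_irreducible_decomposition [FiniteDimensional ℂ H]
    {U : G →* (H ≃ₗᵢ[ℂ] H)} (S : Submodule ℂ H)
    (hS : IsInvariantSubspace U S) : ∃ s : Finset (Submodule ℂ H),
    (∀ M ∈ s, IsIrreducibleSubspace U M) ∧ (s : Set (Submodule ℂ H)).Pairwise (· ⟂ ·) ∧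
      s.sup id = S := by
  induction S using WellFoundedLT.induction with
  | ind S ih =>
    by_cases hS0 : S = ⊥
    · exact ⟨∅, by simp, by simp, by simp [hS0]⟩
    · obtain ⟨M, hMS, hM⟩ := exists_isIrreducibleSubspace_le hS hS0
      have hsup : M ⊔ Mᗮ ⊓ S = S := Submodule.sup_orthogonal_inf_of_hasOrthogonalProjection hMS
      -- Equality would put `M` inside its own orthogonal complement.
      have hlt : Mᗮ ⊓ S < S := by
        refine lt_of_le_of_ne inf_le_right fun h => hM.ne_bot ?_
        rw [inf_eq_right] at h
        have h2 := M.inf_orthogonal_eq_bot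
        rwa [inf_eq_left.2 (hMS.trans h)] at h2
      obtain ⟨s, hs, hort, hssup⟩ := ih _ hlt (hM.invariant.orthogonal.inf hS)
      refine ⟨insert M s, ?_, ?_, ?_⟩
      · simpa using ⟨hM, hs⟩
      · rw [Finset.coe_insert]
        refine Set.pairwise_insert.2 ⟨hort, fun N hN _ => ?_⟩
        have hN' : N ⟂ M := (Finset.le_sup (f := id) hN).trans (hssup.le.trans inf_le_left)
        exact ⟨hN'.symm, hN'⟩
      · rw [Finset.sup_insert, hssup, id, hsup]

/-- The matrix of `U g` in an orthonormal basis of an invariant subspace. -/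
theorem exists_irrep_of_isIrreducibleSubspace {U : G →* (H ≃ₗᵢ[ℂ] H)} {M : Submodule ℂ H}
    (hM : IsIrreducibleSubspace U M) {k : ℕ} (b : OrthonormalBasis (Fin k) ℂ M) :
    ∃ π : G →* unitaryGroup (Fin k) ℂ, (matrixRep π).IsIrreducible ∧
      ∀ g i, U g (b i) = ∑ j, (π g : Matrix (Fin k) (Fin k) ℂ) j i • (b j : H) := by
  let A (g : G) : Matrix (Fin k) (Fin k) ℂ := Matrix.of fun j i => inner ℂ (b j : H) (U g (b i))
  have hA (g : G) (i : Fin k) : U g (b i) = ∑ j, A g j i • (b j : H) := by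
    have h := b.sum_repr' ⟨U g (b i), hM.invariant g _ (b i).2⟩
    have h2 := congrArg (Subtype.val) h
    simpa [A] using h2.symm
  have hb (i j : Fin k) : inner ℂ (b i : H) (b j : H) = if i = j then 1 else 0 := by
    rw [← Submodule.coe_inner, b.inner_eq_ite]
  have hA1 : A 1 = 1 := by
    ext i j
    simp [A, hb, Matrix.one_apply]
  have hAmul (g h : G) : A (g * h) = A g * A h := by
    ext i j
    rw [Matrix.mul_apply]
    simp only [A, of_apply]
    rw [map_mul, LinearIsometryEquiv.coe_mul, Function.comp_apply]
    conv_lhs => rw [hA h, map_sum, inner_sum]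
    refine Finset.sum_congr rfl fun l _ => ?_
    rw [map_smul, inner_smul_right, mul_comm]
    rfl
  have hAstar (g : G) : star (A g) = A g⁻¹ := by
    ext i j
    simp only [A, star_apply, of_apply]
    rw [← inner_map_left]
    exact inner_conj_symm _ _
  have hmem (g : G) : A g ∈ unitaryGroup (Fin k) ℂ := by
    rw [mem_unitaryGroup_iff, hAstar, ← hAmul, mul_inv_cancel, hA1]
  let π : G →* unitaryGroup (Fin k) ℂ :=
    { toFun := fun g => ⟨A g, hmem g⟩
      map_one' := Subtype.ext hA1
      map_mul' := fun g h => Subtype.ext (hAmul g h) }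
  refine ⟨π, ?_, hA⟩
  -- `J` is an equivariant injection with range `M`; it carries subrepresentations to invariant
  -- subspaces of `M`, so minimality of `M` gives irreducibility.
  let J : (Fin k → ℂ) →ₗ[ℂ] H :=
    M.subtype ∘ₗ b.toBasis.equivFun.symm.toLinearMap
  have hJ : Function.Injective J := M.injective_subtype.comp b.toBasis.equivFun.symm.injective
  have hJe (x : Fin k → ℂ) : J x = ∑ i, x i • (b i : H) := by
    change ((b.toBasis.equivFun.symm x : M) : H) = _
    rw [Module.Basis.equivFun_symm_apply]
    simp
  have hJU (g : G) (x : Fin k → ℂ) : J (matrixRep π g x) = U g (J x) := by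
    change J (A g *ᵥ x) = _
    rw [hJe, hJe, map_sum]
    simp_rw [map_smul, hA, Finset.smul_sum, mulVec, dotProduct, Finset.sum_smul, smul_smul]
    rw [Finset.sum_comm]
    simp_rw [mul_comm]
  have hJtop : Submodule.map J ⊤ = M := by
    simp [J]
  refine { exists_pair_ne := ⟨⊥, ⊤, fun h => hM.ne_bot ?_⟩, eq_bot_or_eq_top := fun N => ?_ }
  · have h2 : (⊥ : Submodule ℂ (Fin k → ℂ)) = ⊤ := congrArg Subrepresentation.toSubmodule h
    rw [← hJtop, ← h2, Submodule.map_bot]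
  · by_cases hN : N.toSubmodule.map J = ⊥
    · left
      apply Subrepresentation.toSubmodule_injective
      change N.toSubmodule = ⊥
      exact Submodule.map_injective_of_injective hJ (by rw [hN, Submodule.map_bot])
    · right
      apply Subrepresentation.toSubmodule_injective
      change N.toSubmodule = ⊤
      refine Submodule.map_injective_of_injective hJ ?_
      rw [hJtop]
      refine hM.minimal _ (hJtop ▸ Submodule.map_mono le_top) ?_ hN
      rintro g _ ⟨x, hx, rfl⟩
      exact ⟨matrixRep π g x, N.apply_mem_toSubmodule g hx, hJU g x⟩

/-- Grouping equivalent irreps turns a basis adapted to a decomposition into irreps into an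
`IrrepDecomposition`. -/
theorem nonempty_irrepDecomposition_of_basis {U : G →* (H ≃ₗᵢ[ℂ] H)} {ι : Type*} [Fintype ι]
    {k : ι → ℕ} (b : OrthonormalBasis (Σ x, Fin (k x)) ℂ H)
    (π : ∀ x, G →* unitaryGroup (Fin (k x)) ℂ) (hπ : ∀ x, (matrixRep (π x)).IsIrreducible)
    (hb : ∀ g x i, U g (b ⟨x, i⟩) =
      ∑ j, (π x g : Matrix (Fin (k x)) (Fin (k x)) ℂ) j i • b ⟨x, j⟩) :
    Nonempty (IrrepDecomposition U) := by
  classical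
  let r : Setoid ι :=
    { r := fun x y => Nonempty ((matrixRep (π x)).Equiv (matrixRep (π y)))
      iseqv := ⟨fun x => ⟨.refl _⟩, fun ⟨f⟩ => ⟨f.symm⟩, fun ⟨f⟩ ⟨f'⟩ => ⟨f.trans f'⟩⟩ }
  let q : Quotient r ≃ Fin (Fintype.card (Quotient r)) := Fintype.equivFin _
  let rep (μ : Fin (Fintype.card (Quotient r))) : ι := (q.symm μ).out
  let fiber (μ : Fin (Fintype.card (Quotient r))) : Type _ := {x : ι // q ⟦x⟧ = μ}
  let ε (μ : Fin (Fintype.card (Quotient r))) : fiber μ ≃ Fin (Fintype.card (fiber μ)) :=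
    Fintype.equivFin _
  have hrep (μ) : q ⟦rep μ⟧ = μ := by simp [rep]
  let y (μ) (a : Fin (Fintype.card (fiber μ))) : ι := ((ε μ).symm a).1
  have hy (μ) (a : Fin (Fintype.card (fiber μ))) : q ⟦y μ a⟧ = μ := ((ε μ).symm a).2
  have hex (μ) (a : Fin (Fintype.card (fiber μ))) :
      Nonempty ((matrixRep (π (rep μ))).Equiv (matrixRep (π (y μ a)))) :=
    Quotient.exact (q.injective ((hrep μ).trans (hy μ a).symm))
  choose T hT1 hT2 hT using fun μ a => exists_unitary_intertwiner (hπ (rep μ)) (hex μ a).some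
  -- Each class `μ` has a representative, and its members are the copies labelled by `a`. The
  -- unitary `T μ a` transports the representative's basis into the copy, so that `G` acts by the
  -- same matrix in all copies.
  let v (p : Σ μ, Fin (k (rep μ)) × Fin (Fintype.card (fiber μ))) : H :=
    ∑ j, T p.1 p.2.2 j p.2.1 • b ⟨y p.1 p.2.2, j⟩
  have hv (μ) (i : Fin (k (rep μ))) (a : Fin (Fintype.card (fiber μ))) :
      v ⟨μ, (i, a)⟩ = ∑ j, T μ a j i • b ⟨y μ a, j⟩ := rfl
  have hvort : Orthonormal ℂ v := by
    rw [orthonormal_iff_ite]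
    rintro ⟨μ, i, a⟩ ⟨ν, j, c⟩
    by_cases h : (⟨μ, a⟩ : Σ μ, Fin (Fintype.card (fiber μ))) = ⟨ν, c⟩
    · obtain ⟨rfl, h⟩ := Sigma.mk.inj_iff.1 h
      obtain rfl := eq_of_heq h
      have h1 := congrFun₂ (hT1 μ a) i j
      rw [Matrix.one_apply, Matrix.mul_apply] at h1
      simp only [v, sum_inner, inner_sum, inner_smul_left, inner_smul_right, b.inner_eq_ite]
      simpa [mul_comm] using h1
    · have hne : y μ a ≠ y ν c := by
        intro h2
        have hμν : μ = ν := by rw [← hy μ a, h2, hy ν c]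
        subst hμν
        exact h (by rw [(ε μ).symm.injective (Subtype.ext h2)])
      rw [if_neg (by rintro h3; cases h3; exact h rfl)]
      simp only [v, sum_inner, inner_sum, inner_smul_left, inner_smul_right, b.inner_eq_ite]
      simp [hne]
  have hvspan : ⊤ ≤ Submodule.span ℂ (Set.range v) := by
    rw [← b.toBasis.span_eq, Submodule.span_le]
    rintro _ ⟨⟨x, j⟩, rfl⟩
    obtain ⟨μ, a, rfl⟩ : ∃ μ a, y μ a = x :=
      ⟨q ⟦x⟧, ε _ ⟨x, rfl⟩, by simp [y]⟩
    -- `T Tᴴ = 1` recovers the old basis from the new one.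
    have h1 : b ⟨y μ a, j⟩ = ∑ i, star (T μ a j i) • v ⟨μ, (i, a)⟩ := by
      simp_rw [hv, Finset.smul_sum, smul_smul]
      rw [Finset.sum_comm]
      simp_rw [← Finset.sum_smul]
      have h2 (l : Fin (k (y μ a))) : ∑ i, star (T μ a j i) * T μ a l i =
          if l = j then 1 else 0 := by
        have h3 := congrFun₂ (hT2 μ a) l j
        rw [Matrix.one_apply, Matrix.mul_apply] at h3
        rw [← h3]
        exact Finset.sum_congr rfl fun i _ => mul_comm _ _
      simp_rw [h2]
      simp
    rw [b.coe_toBasis, h1]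
    exact Submodule.sum_mem _ fun i _ => Submodule.smul_mem _ _ (Submodule.subset_span ⟨_, rfl⟩)
  exact ⟨{
    numIrreps := Fintype.card (Quotient r)
    dim := fun μ => k (rep μ)
    mult := fun μ => Fintype.card (fiber μ)
    mult_pos := fun μ => Fintype.card_pos_iff.2 ⟨⟨rep μ, hrep μ⟩⟩
    irrep := fun μ => π (rep μ)
    irreducible := fun μ => hπ (rep μ)
    inequivalent := fun μ ν hμν => ⟨fun f => hμν (by
      rw [← hrep μ, ← hrep ν]
      exact congrArg q (Quotient.sound ⟨f⟩))⟩
    basis := OrthonormalBasis.mk hvort hvspan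
    map_basis := fun g μ i a => by
      simp_rw [OrthonormalBasis.coe_mk, hv, map_sum, map_smul, hb, Finset.smul_sum, smul_smul]
      rw [Finset.sum_comm]
      refine Eq.trans ?_ Finset.sum_comm
      simp_rw [← Finset.sum_smul]
      refine Finset.sum_congr rfl fun l _ => ?_
      have h1 := congrFun₂ (hT μ a g) l i
      rw [Matrix.mul_apply, Matrix.mul_apply] at h1
      congr 1
      simp_rw [mul_comm (T μ a _ i)]
      rw [← h1]
      exact Finset.sum_congr rfl fun _ _ => mul_comm _ _ }⟩

theorem nonempty_irrepDecomposition [FiniteDimensional ℂ H]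
    (U : G →* (H ≃ₗᵢ[ℂ] H)) :
    Nonempty (IrrepDecomposition U) := by
  classical
  obtain ⟨s, hs, hort, hsup⟩ := exists_orthogonal_irreducible_decomposition (U := U) ⊤
    fun _ _ _ => Submodule.mem_top
  have hV : OrthogonalFamily ℂ (fun M : s => (M : Submodule ℂ H))
      fun M => (M : Submodule ℂ H).subtypeₗᵢ :=
    OrthogonalFamily.of_pairwise fun M N hMN =>
      hort M.2 N.2 fun h => hMN (Subtype.ext h)
  have htop : ⨆ M : s, (M : Submodule ℂ H) = ⊤ := by
    rw [← hsup, Finset.sup_eq_iSup, iSup_subtype]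
    rfl
  have hint : DirectSum.IsInternal fun M : s => (M : Submodule ℂ H) := by
    rw [hV.isInternal_iff, htop, Submodule.top_orthogonal_eq_bot]
  let e (M : s) := stdOrthonormalBasis ℂ (M : Submodule ℂ H)
  choose π hπ hmap using fun M : s => exists_irrep_of_isIrreducibleSubspace (hs M M.2) (e M)
  refine nonempty_irrepDecomposition_of_basis (hint.collectedOrthonormalBasis hV e) π hπ ?_
  intro g M i
  simpa [DirectSum.IsInternal.collectedOrthonormalBasis] using hmap M g i

end Existence

end

/-- The first conjunct ensures that the quantification over decompositions is not vacuous. -/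
theorem mainTheorem9 {G : Type*} [Group G] [TopologicalSpace G] [IsTopologicalGroup G]
    [CompactSpace G] [T2Space G] [MeasurableSpace G] [BorelSpace G]
    (haar : MeasureTheory.Measure G) [haar.IsHaarMeasure] [MeasureTheory.IsProbabilityMeasure haar]
    {H : Type*} [NormedAddCommGroup H] [InnerProductSpace ℂ H] [FiniteDimensional ℂ H]
    (U : G →* (H ≃ₗᵢ[ℂ] H)) (hU : ∀ v : H, Continuous fun g => U g v)
    (ψ₁ ψ₂ : H) (hψ₁ : ‖ψ₁‖ = 1) (hψ₂ : ‖ψ₂‖ = 1) :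
    Nonempty (IrrepDecomposition U) ∧
    ∀ D : IrrepDecomposition U, ∃ V : H ≃ₗᵢ[ℂ] H, IsGInvariant U V ∧
      1 - 1 / 2 * (∑ μ ∈ D.jointSupport ψ₁ ψ₂, (D.dim μ : ℝ) ^ 2) *
          ∫ g, ‖stateCharFun U ψ₁ g - stateCharFun U ψ₂ g‖ ∂haar
        ≤ ‖inner ℂ ψ₂ (V ψ₁)‖ ∧
      1 - 1 / 2 * ∑ μ ∈ D.jointSupport ψ₁ ψ₂, (D.dim μ : ℝ) ^ 2 *
          ∫ g, ‖D.charFunComponent ψ₁ μ g - D.charFunComponent ψ₂ μ g‖ ∂haar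
        ≤ ‖inner ℂ ψ₂ (V ψ₁)‖ := by
  exact ⟨nonempty_irrepDecomposition U, fun D => overlap_bounds haar hU hψ₁ hψ₂ D⟩
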